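/- Let $M$ be a smooth manifold (Hausdorff, second countable, without boundary, of dimension $n\ge 0$), let $\Lambda$ be a smooth bivector field and $\varphi$ a smooth $3$-form on $M$. Let $\Lambda^\sharp:\Gamma(T^*M)\to\Gamma(TM)$ be given by $\langle\beta,\Lambda^\sharp(\alpha)\rangle=\Lambda(\alpha,\beta)$, and extend it to $\Lambda^\sharp:\Gamma(\bigwedge^kT^*M)\to\Gamma(\bigwedge^kTM)$, $k\ge 0$, by $$\Lambda^\sharp(\eta)(\alpha_1,\dots,\alpha_k)=(-1)^k\,\eta(\Lambda^\sharp(\alpha_1),\dots,\Lambda^\sharp(\alpha_k)),\qquad \Lambda^\sharp(f)=f\ \text{ for } f\in C^\infty(M,\mathbb R).$$ Assume that $(M,\Lambda,\varphi)$ is a twisted Poisson manifold, i.e. $d\varphi=0$ and $\tfrac12[\Lambda,\Lambda]=\Lambda^\sharp(\varphi)$, where $[\cdot,\cdot]$ is the Schouten bracket with the sign convention for which $\tfrac12[\Lambda,\Lambda](df,dg,dh)=\{f,\{g,h\}\}+\{g,\{h,f\}\}+\{h,\{f,g\}\}$ with $\{f,g\}=\Lambda(df,dg)$. For $\alpha,\beta\in\Gamma(T^*M)$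 put $$\{\alpha,\beta\}^\varphi=\mathcal L_{\Lambda^\sharp(\alpha)}\beta-\mathcal L_{\Lambda^\sharp(\beta)}\alpha-d(\Lambda(\alpha,\beta))+\varphi(\Lambda^\sharp(\alpha),\Lambda^\sharp(\beta),\cdot),$$ and for $P\in\Gamma(\bigwedge^kTM)$ define $\partial_\varphi P\in\Gamma(\bigwedge^{k+1}TM)$ by $$\partial_\varphi P(\alpha_1,\dots,\alpha_{k+1})=\sum_{i}(-1)^{i+1}\Lambda^\sharp(\alpha_i)\bigl(P(\alpha_1,\dots,\widehat{\alpha_i},\dots,\alpha_{k+1})\bigr)+\sum_{i<j}(-1)^{i+j}P(\{\alpha_i,\alpha_j\}^\varphi,\alpha_1,\dots,\widehat{\alpha_i},\dots,\widehat{\alpha_j},\dots,\alpha_{k+1}).$$ Let $H^k_{L\text{-}tP}(M)$ be the degree-$k$ cohomology of $(\Gamma(\bigwedge TM),\partial_\varphi)$ (the Lichnerowicz-twisted Poisson cohomology), $[P]^\varphi$ the class of $P\in\ker\partial_\varphi$, and $H^k_{dR}(M,\mathbb R)$ the de Rham cohomology of $M$. Then: 1. $\partial_\varphi(\Lambda^\sharp(\eta))=-\Lambda^\sharp(d\eta)$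 for every $k\ge 0$ and every smooth $k$-form $\eta$. 2. For every $k\ge0$ there is a well-defined $\mathbb R$-linear map $\Lambda^\sharp:H^k_{dR}(M,\mathbb R)\to H^k_{L\text{-}tP}(M)$, $[\eta]\mapsto[\Lambda^\sharp(\eta)]^\varphi$ (in particular $\partial_\varphi(\Lambda^\sharp(\eta))=0$ whenever $d\eta=0$). 3. If $\Lambda$ is nondegenerate (i.e. the bilinear form $\Lambda_x$ on $T_x^*M$ is nondegenerate for every $x\in M$), then the map in 2 is an isomorphism for every $k\ge 0$. -/

import Mathlib

open scoped Manifold ContDiff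

noncomputable section

namespace TwistedPoisson

/-- The quotient `Z / B` of two subspaces of a real vector space (in general `Z / (Z ∩ B)`; below,
`B` is contained in `Z`). -/
def Subquotient {V : Type*} [AddCommGroup V] [Module ℝ V] (Z B : Submodule ℝ V) : Type _ :=
  Z ⧸ B.submoduleOf Z

namespace Subquotient
variable {V : Type*} [AddCommGroup V] [Module ℝ V] (Z B : Submodule ℝ V)

instance : AddCommGroup (Subquotient Z B) := inferInstanceAs (AddCommGroup (Z ⧸ B.submoduleOf Z))

instance : Module ℝ (Subquotient Z B) := inferInstanceAs (Module ℝ (Z ⧸ B.submoduleOf Z))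

/-- The class of an element of `Z`. -/
def mk (v : V) (hv : v ∈ Z) : Subquotient Z B :=
  Submodule.Quotient.mk (p := B.submoduleOf Z) ⟨v, hv⟩

end Subquotient

/-- A skew-symmetric bracket on an `A`-module `L` with an anchor into the derivations of `A`,
subject to the Leibniz rule: a Lie algebroid structure on sections, without the Jacobi identity.
It is used below for two concrete brackets only, the Lie bracket of vector fields and the bracket
of `1`-forms of a twisted Poisson manifold. -/
structure AnchoredBracket (A L : Type*) [CommRing A] [Algebra ℝ A] [AddCommGroup L] [Module A L] where
  anchor : L →ₗ[A] Derivation ℝ A A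
  bracket : L → L → L
  bracket_skew : ∀ X Y, bracket X Y = - bracket Y X
  bracket_add : ∀ X Y Z, bracket X (Y + Z) = bracket X Y + bracket X Z
  bracket_smul : ∀ X (f : A) Y, bracket X (f • Y) = f • bracket X Y + anchor X f • Y

namespace AnchoredBracket
variable {A L : Type*} [CommRing A] [Algebra ℝ A] [AddCommGroup L] [Module A L]

/-- The sum `∑_{i < j} (-1)^(i+j) P([α_i, α_j], α_0, …, α̂_i, …, α̂_j, …, α_k)` for a `k`-linear
alternating `P`. A pair `i < j` of indices in `Fin (k + 2)` is encoded as `(i.castSucc, j.succ)`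
with `i ≤ j` in `Fin (k + 1)`. For a form of degree zero the sum is empty. -/
def bracketSum (B : AnchoredBracket A L) : {k : ℕ} → (L [⋀^Fin k]→ₗ[A] A) → (Fin (k + 1) → L) → A
  | 0, _, _ => 0
  | k + 1, P, α => ∑ i : Fin (k + 1), ∑ j ∈ Finset.Ici i, (-1 : A) ^ ((i : ℕ) + ((j : ℕ) + 1)) *
      P (Fin.cons (B.bracket (α i.castSucc) (α j.succ)) (j.removeNth (i.castSucc.removeNth α)))

/-- The values of the exterior derivative:
`(dP)(α_0, …, α_k) = ∑_i (-1)^i ρ(α_i)(P(α_0, …, α̂_i, …, α_k))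
  + ∑_{i < j} (-1)^(i+j) P([α_i, α_j], α_0, …, α̂_i, …, α̂_j, …, α_k)`. -/
def diffFun (B : AnchoredBracket A L) {k : ℕ} (P : L [⋀^Fin k]→ₗ[A] A) (α : Fin (k + 1) → L) : A :=
  ∑ i : Fin (k + 1), (-1 : A) ^ (i : ℕ) * B.anchor (α i) (P (i.removeNth α)) + B.bracketSum P α

theorem bracket_add_left (B : AnchoredBracket A L) (X Y Z : L) :
    B.bracket (X + Y) Z = B.bracket X Z + B.bracket Y Z := by
  rw [B.bracket_skew, B.bracket_add, B.bracket_skew Z X, B.bracket_skew Z Y]; abel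

theorem bracket_smul_left (B : AnchoredBracket A L) (X : L) (f : A) (Z : L) :
    B.bracket (f • X) Z = f • B.bracket X Z - B.anchor Z f • X := by
  rw [B.bracket_skew, B.bracket_smul, B.bracket_skew Z X]; simp [sub_eq_add_neg, add_comm]

section real
variable [Module ℝ L] [IsScalarTower ℝ A L]

/-- The bracket as an `ℝ`-bilinear map. -/
def bracketLM (B : AnchoredBracket A L) : L →ₗ[ℝ] L →ₗ[ℝ] L :=
  LinearMap.mk₂ ℝ B.bracket B.bracket_add_left
    (fun c X Y => by
      have h := B.bracket_smul_left X (algebraMap ℝ A c) Y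
      simpa using h)
    B.bracket_add
    (fun c X Y => by
      have h := B.bracket_smul X (algebraMap ℝ A c) Y
      simpa using h)

/-- `P` as an `ℝ`-multilinear alternating map. -/
def realAlt {k : ℕ} (P : L [⋀^Fin k]→ₗ[A] A) : L [⋀^Fin k]→ₗ[ℝ] A :=
  { P.toMultilinearMap.restrictScalars ℝ with
    map_eq_zero_of_eq' := fun v _ _ h hij => P.map_eq_zero_of_eq v h hij }

@[simp] theorem realAlt_apply {k : ℕ} (P : L [⋀^Fin k]→ₗ[A] A) (v : Fin k → L) :
    realAlt P v = P v := rfl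

/-- The map `X ↦ ρ(X) ∘ P`. -/
def anchorPart (B : AnchoredBracket A L) {k : ℕ} (P : L [⋀^Fin k]→ₗ[A] A) :
    L →ₗ[ℝ] L [⋀^Fin k]→ₗ[ℝ] A where
  toFun X := (B.anchor X : A →ₗ[ℝ] A).compAlternatingMap (realAlt P)
  map_add' X Y := by ext; simp
  map_smul' c X := by
    ext v
    have h : B.anchor (c • X) = c • B.anchor X := by
      rw [← algebraMap_smul A c X, map_smul, algebraMap_smul]
    simp [h]

/-- The defining formula is alternating and additive; the bracket sum is half of a
double alternatization. -/
theorem exists_real (B : AnchoredBracket A L) {k : ℕ} (P : L [⋀^Fin k]→ₗ[A] A) :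
    ∃ Q : L [⋀^Fin (k + 1)]→ₗ[ℝ] A, ∀ α, Q α = B.diffFun P α := by
  cases k with
  | zero =>
    refine ⟨AlternatingMap.alternatizeUncurryFin (B.anchorPart P), fun α => ?_⟩
    simp [AlternatingMap.alternatizeUncurryFin_apply, diffFun, bracketSum, anchorPart]
  | succ k =>
    let f : L →ₗ[ℝ] L →ₗ[ℝ] L [⋀^Fin k]→ₗ[ℝ] A := B.bracketLM.compr₂ (realAlt P).curryLeft
    refine ⟨AlternatingMap.alternatizeUncurryFin (B.anchorPart P) - (1 / 2 : ℝ) •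
      AlternatingMap.alternatizeUncurryFin (AlternatingMap.alternatizeUncurryFinLM ∘ₗ f),
      fun α => ?_⟩
    rw [AlternatingMap.sub_apply, AlternatingMap.smul_apply,
      AlternatingMap.alternatizeUncurryFin_alternatizeUncurryFinLM_comp_apply,
      AlternatingMap.alternatizeUncurryFin_apply, diffFun, sub_eq_add_neg]
    congr 1
    · refine Finset.sum_congr rfl fun i _ => ?_
      simp [anchorPart, zsmul_eq_mul]
    · rw [bracketSum, Finset.smul_sum, ← Finset.sum_neg_distrib]
      refine Finset.sum_congr rfl fun i _ => ?_
      rw [Finset.smul_sum, ← Finset.sum_neg_distrib]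
      refine Finset.sum_congr rfl fun j _ => ?_
      have hs : B.bracket (α j.succ) (α i.castSucc) = - B.bracket (α i.castSucc) (α j.succ) :=
        B.bracket_skew _ _
      have h1 : ∀ X Y v, f X Y v = P (Fin.cons (B.bracket X Y) v) := fun X Y v => rfl
      have h2 : ∀ (X : L) v, P (Fin.cons (-X) v) = - P (Fin.cons X v) := fun X v => 
        congrArg (fun g => g v) (P.curryLeft.map_neg X)
      rw [h1, h1, hs, h2, sub_neg_eq_add, ← two_smul ℝ (P _), smul_comm (1 / 2 : ℝ), smul_smul]
      rw [← add_assoc, pow_succ]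
      simp [zsmul_eq_mul]

theorem cons_smul {k : ℕ} (P : L [⋀^Fin (k + 1)]→ₗ[A] A) (a : A) (x : L) (v : Fin k → L) :
    P (Fin.cons (a • x) v) = a * P (Fin.cons x v) :=
  congrArg (fun g => g v) (P.curryLeft.map_smul a x)

theorem cons_sub {k : ℕ} (P : L [⋀^Fin (k + 1)]→ₗ[A] A) (x y : L) (v : Fin k → L) :
    P (Fin.cons (x - y) v) = P (Fin.cons x v) - P (Fin.cons y v) :=
  congrArg (fun g => g v) (P.curryLeft.map_sub x y)

theorem removeNth_succ_cons {k : ℕ} (i : Fin (k + 1)) (x : L) (w : Fin (k + 1) → L) :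
    (i.succ.removeNth (Fin.cons x w : Fin (k + 2) → L) : Fin (k + 1) → L) =
      Fin.cons x (i.removeNth w) := by
  ext j
  refine Fin.cases ?_ (fun j => ?_) j <;> simp [Fin.removeNth]

theorem diffFun_cons_smul (B : AnchoredBracket A L) {k : ℕ} (P : L [⋀^Fin k]→ₗ[A] A)
    (a : A) (x : L) (w : Fin k → L) :
    B.diffFun P (Fin.cons (a • x) w) = a * B.diffFun P (Fin.cons x w) := by
  cases k with
  | zero => simp [diffFun, bracketSum]
  | succ k =>
    have h1 : ∀ z : L, ∑ i : Fin (k + 2), (-1 : A) ^ (i : ℕ) *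
          B.anchor ((Fin.cons z w : Fin (k + 2) → L) i)
            (P (i.removeNth (Fin.cons z w : Fin (k + 2) → L))) =
        B.anchor z (P w) + ∑ i : Fin (k + 1), (-1 : A) ^ ((i : ℕ) + 1) *
          B.anchor (w i) (P (Fin.cons z (i.removeNth w))) := fun z => by
      rw [Fin.sum_univ_succ]
      simp only [removeNth_succ_cons, Fin.cons_succ, Fin.val_succ]
      simp [Fin.removeNth_zero]
    have h2 : ∀ z : L, B.bracketSum P (Fin.cons z w) =
        ∑ j : Fin (k + 1), (-1 : A) ^ ((j : ℕ) + 1) *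
            P (Fin.cons (B.bracket z (w j)) (j.removeNth w)) +
          ∑ i : Fin k, ∑ j ∈ Finset.Ici i.succ, (-1 : A) ^ ((i.succ : ℕ) + ((j : ℕ) + 1)) *
            P (Fin.cons (B.bracket (w i.castSucc) (w j))
              (j.removeNth (i.castSucc.succ.removeNth (Fin.cons z w : Fin (k + 2) → L)))) := by
      intro z
      have hI : Finset.Ici (0 : Fin (k + 1)) = Finset.univ := by ext; simp
      rw [bracketSum, Fin.sum_univ_succ, hI]
      simp [Fin.removeNth_zero, Fin.castSucc_succ]
    have h3 : ∀ (i : Fin k) (j : Fin (k + 1)), j ∈ Finset.Ici i.succ →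
        P (Fin.cons (B.bracket (w i.castSucc) (w j))
          (j.removeNth (i.castSucc.succ.removeNth (Fin.cons (a • x) w : Fin (k + 2) → L)))) =
        a * P (Fin.cons (B.bracket (w i.castSucc) (w j))
          (j.removeNth (i.castSucc.succ.removeNth (Fin.cons x w : Fin (k + 2) → L)))) := by
      intro i j hj
      cases k with
      | zero => exact i.elim0
      | succ k =>
        obtain ⟨j', rfl⟩ : ∃ j', j = Fin.succ j' :=
          Fin.exists_succ_eq.2 (fun h => by simp [h] at hj) |>.imp fun _ => Eq.symm
        rw [removeNth_succ_cons, removeNth_succ_cons, removeNth_succ_cons, removeNth_succ_cons]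
        exact cons_smul (P.curryLeft _) a x _
    have h4 : ∀ (i : Fin k) (j : Fin (k + 1)), j ∈ Finset.Ici i.succ →
        (-1 : A) ^ ((i.succ : ℕ) + ((j : ℕ) + 1)) *
        P (Fin.cons (B.bracket (w i.castSucc) (w j))
          (j.removeNth (i.castSucc.succ.removeNth (Fin.cons (a • x) w : Fin (k + 2) → L)))) =
        a * ((-1 : A) ^ ((i.succ : ℕ) + ((j : ℕ) + 1)) *
        P (Fin.cons (B.bracket (w i.castSucc) (w j))
          (j.removeNth (i.castSucc.succ.removeNth (Fin.cons x w : Fin (k + 2) → L))))) := by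
      intro i j hj
      rw [h3 i j hj]; ring
    rw [diffFun, diffFun, h1, h1, h2, h2,
      Finset.sum_congr rfl fun i _ => Finset.sum_congr rfl (h4 i)]
    simp only [cons_smul, bracket_smul_left, cons_sub, map_smul, Derivation.smul_apply,
      Derivation.leibniz, smul_eq_mul, ← Finset.mul_sum, mul_add, mul_sub, Finset.sum_add_distrib,
      Finset.sum_sub_distrib]
    simp only [Finset.mul_sum]
    have h5 : ∀ j : Fin (k + 1), (-1 : A) ^ ((j : ℕ) + 1) *
        (P (Fin.cons x (j.removeNth w)) * B.anchor (w j) a) =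
        (-1 : A) ^ ((j : ℕ) + 1) * (B.anchor (w j) a * P (Fin.cons x (j.removeNth w))) :=
      fun j => by ring
    simp only [h5, mul_left_comm a]
    ring

/-- The exterior derivative of an alternating form, as an alternating form. -/
def diff (B : AnchoredBracket A L) {k : ℕ} (P : L [⋀^Fin k]→ₗ[A] A) :
    L [⋀^Fin (k + 1)]→ₗ[A] A where
  toFun := B.diffFun P
  map_update_add' v i x y := by
    obtain ⟨Q, hQ⟩ := B.exists_real P
    rw [← hQ, ← hQ, ← hQ]
    convert Q.map_update_add v i x y
  map_update_smul' v i c x := by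
    obtain ⟨Q, hQ⟩ := B.exists_real P
    have h : ∀ z : L, B.diffFun P (Function.update v i z) =
        Equiv.Perm.sign (Equiv.swap 0 i) •
          B.diffFun P (Fin.cons z fun j => v (Equiv.swap 0 i j.succ)) := by
      intro z
      have : (Fin.cons z fun j => v (Equiv.swap 0 i j.succ)) =
          Function.update v i z ∘ Equiv.swap 0 i := by
        ext j
        refine Fin.cases ?_ (fun j => ?_) j
        · simp
        · have : Equiv.swap 0 i j.succ ≠ i := by
            intro h
            have := congrArg (Equiv.swap 0 i) h
            simp at this
          simp [this]
      rw [this, ← hQ, ← hQ, Q.map_perm, smul_smul, Int.units_mul_self, one_smul]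
    show B.diffFun P _ = c • B.diffFun P _
    rw [h, h, diffFun_cons_smul, smul_eq_mul]
    simp [Units.smul_def]
  map_eq_zero_of_eq' v i j h hij := by
    obtain ⟨Q, hQ⟩ := B.exists_real P
    rw [← hQ]
    exact Q.map_eq_zero_of_eq v h hij

theorem diffFun_add (B : AnchoredBracket A L) {k : ℕ} (P Q : L [⋀^Fin k]→ₗ[A] A)
    (α : Fin (k + 1) → L) : B.diffFun (P + Q) α = B.diffFun P α + B.diffFun Q α := by
  cases k with
  | zero => simp [diffFun, bracketSum]
  | succ k =>
    simp only [diffFun, bracketSum, AlternatingMap.add_apply, map_add, mul_add,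
      Finset.sum_add_distrib]
    ring

theorem diffFun_smul (B : AnchoredBracket A L) {k : ℕ} (c : ℝ) (P : L [⋀^Fin k]→ₗ[A] A)
    (α : Fin (k + 1) → L) : B.diffFun (c • P) α = c • B.diffFun P α := by
  cases k with
  | zero => simp [diffFun, bracketSum]
  | succ k =>
    simp only [diffFun, bracketSum, AlternatingMap.smul_apply, Derivation.map_smul,
      mul_smul_comm, ← Finset.smul_sum, smul_add]

/-- The exterior derivative as an `ℝ`-linear map from degree `k` to degree `k + 1`. -/
def diffLM (B : AnchoredBracket A L) (k : ℕ) :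
    (L [⋀^Fin k]→ₗ[A] A) →ₗ[ℝ] L [⋀^Fin (k + 1)]→ₗ[A] A where
  toFun P := B.diff P
  map_add' P Q := by
    ext α
    exact B.diffFun_add P Q α
  map_smul' c P := by
    ext α
    exact B.diffFun_smul c P α

/-- The cocycles of degree `k`: the kernel of the derivative. -/
def cocycles (B : AnchoredBracket A L) (k : ℕ) : Submodule ℝ (L [⋀^Fin k]→ₗ[A] A) :=
  LinearMap.ker (B.diffLM k)

/-- The coboundaries of degree `k`: the image of the derivative from degree `k - 1`, which is zero
for `k = 0`. -/
def coboundaries (B : AnchoredBracket A L) : (k : ℕ) → Submodule ℝ (L [⋀^Fin k]→ₗ[A] A)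
  | 0 => ⊥
  | k + 1 => LinearMap.range (B.diffLM k)

/-- The cohomology in degree `k`: cocycles modulo coboundaries. -/
abbrev Cohomology (B : AnchoredBracket A L) (k : ℕ) : Type _ :=
  Subquotient (B.cocycles k) (B.coboundaries k)

/-- The cohomology class of a cocycle. -/
def cohomologyClass (B : AnchoredBracket A L) {k : ℕ} (P : L [⋀^Fin k]→ₗ[A] A)
    (hP : B.diff P = 0) : B.Cohomology k :=
  Subquotient.mk (B.cocycles k) (B.coboundaries k) P hP

end real
end AnchoredBracket

variable (n : ℕ) (M : Type*) [TopologicalSpace M] [ChartedSpace (EuclideanSpace ℝ (Fin n)) M]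
  [IsManifold (𝓡 n) ∞ M]

/-- The algebra `C^∞(M, ℝ)`. -/
abbrev SmoothFunction := C^∞⟮𝓡 n, M; 𝓘(ℝ, ℝ), ℝ⟯
/-- The smooth vector fields `Γ(TM)`. -/
abbrev SmoothVectorField := Cₛ^∞⟮𝓡 n; EuclideanSpace ℝ (Fin n), (TangentSpace (𝓡 n) : M → Type)⟯

variable {n M}

/-- Multiplication of vector fields by smooth functions, `(f X)_x = f(x) X_x`. -/
instance : SMul (SmoothFunction n M) (SmoothVectorField n M) where
  smul f X := ⟨fun x => f x • X x, f.contMDiff.smul_section X.contMDiff⟩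

theorem SmoothVectorField.smul_apply (f : SmoothFunction n M) (X : SmoothVectorField n M) (x : M) : (f • X) x = f x • X x := rfl

instance : Module (SmoothFunction n M) (SmoothVectorField n M) where
  one_smul X := by ext x : 1; simp [SmoothVectorField.smul_apply]
  mul_smul f g X := by ext x : 1; simp [SmoothVectorField.smul_apply, mul_smul]
  smul_zero f := by ext x : 1; simp [SmoothVectorField.smul_apply]
  smul_add f X Y := by ext x : 1; simp [SmoothVectorField.smul_apply]
  add_smul f g X := by ext x : 1; simp [SmoothVectorField.smul_apply, add_smul]
  zero_smul X := by ext x : 1; simp [SmoothVectorField.smul_apply]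

instance : IsScalarTower ℝ (SmoothFunction n M) (SmoothVectorField n M) where
  smul_assoc c f X := by ext x : 1; simp [SmoothVectorField.smul_apply, mul_smul]

variable (n M)

/-- The smooth `1`-forms `Γ(T*M)`, as `C^∞(M)`-linear maps `Γ(TM) → C^∞(M)`. -/
abbrev OneForm := SmoothVectorField n M →ₗ[SmoothFunction n M] SmoothFunction n M

/-- The smooth `k`-forms `Γ(⋀^k T*M)`, as alternating `C^∞(M)`-multilinear maps
`Γ(TM)^k → C^∞(M)`. -/
abbrev DiffForm (k : ℕ) := SmoothVectorField n M [⋀^Fin k]→ₗ[SmoothFunction n M] SmoothFunction n M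

/-- The smooth `k`-vector fields `Γ(⋀^k TM)`, as alternating `C^∞(M)`-multilinear maps
`Γ(T*M)^k → C^∞(M)`. -/
abbrev MultivectorField (k : ℕ) := OneForm n M [⋀^Fin k]→ₗ[SmoothFunction n M] SmoothFunction n M

variable {n M}

theorem contMDiff_mvfderiv (f : SmoothFunction n M) (X : SmoothVectorField n M) :
    ContMDiff (𝓡 n) 𝓘(ℝ, ℝ) ∞ fun x => mvfderiv (𝓡 n) f x (X x) := by
  have h1 : ContMDiff (𝓡 n).tangent 𝓘(ℝ, ℝ).tangent ∞ (tangentMap (𝓡 n) 𝓘(ℝ, ℝ) f) :=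
    f.contMDiff.contMDiff_tangentMap (by simp)
  have h2 := (contMDiff_snd_tangentBundle_modelSpace (n := ∞) ℝ 𝓘(ℝ, ℝ)).comp (h1.comp X.contMDiff)
  exact h2

theorem SmoothFunction.mdiffAt (f : SmoothFunction n M) (x : M) : MDifferentiableAt (𝓡 n) 𝓘(ℝ, ℝ) f x :=
  f.contMDiff.mdifferentiable (by simp) x

/-- The derivative `X f` of a smooth function `f` along a vector field `X`. -/
def SmoothVectorField.deriv (X : SmoothVectorField n M) (f : SmoothFunction n M) : SmoothFunction n M :=
  ⟨fun x => mvfderiv (𝓡 n) f x (X x), contMDiff_mvfderiv f X⟩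

theorem SmoothVectorField.deriv_apply (X : SmoothVectorField n M) (f : SmoothFunction n M) (x : M) :
    X.deriv f x = mvfderiv (𝓡 n) f x (X x) := rfl

theorem SmoothVectorField.deriv_add (X : SmoothVectorField n M) (f g : SmoothFunction n M) :
    X.deriv (f + g) = X.deriv f + X.deriv g := by
  ext x
  simp [SmoothVectorField.deriv_apply, mvfderiv_add (f.mdiffAt x) (g.mdiffAt x)]

theorem SmoothVectorField.deriv_mul (X : SmoothVectorField n M) (f g : SmoothFunction n M) :
    X.deriv (f * g) = f * X.deriv g + g * X.deriv f := by
  ext x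
  simp [SmoothVectorField.deriv_apply, mvfderiv_mul (f.mdiffAt x) (g.mdiffAt x)]

theorem SmoothVectorField.deriv_smul (X : SmoothVectorField n M) (c : ℝ) (f : SmoothFunction n M) :
    X.deriv (c • f) = c • X.deriv f := by
  have h0 : X.deriv (algebraMap ℝ (SmoothFunction n M) c) = 0 := by
    ext x
    exact congrArg (fun T => T (X x)) (mvfderiv_const (I := 𝓡 n) (x := x) c)
  rw [Algebra.smul_def, SmoothVectorField.deriv_mul, h0, mul_zero, add_zero, Algebra.smul_def]

/-- Vector fields act on smooth functions by derivations. -/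
def SmoothVectorField.toDerivation : SmoothVectorField n M →ₗ[SmoothFunction n M] Derivation ℝ (SmoothFunction n M) (SmoothFunction n M) where
  toFun X := Derivation.mk'
    { toFun := X.deriv
      map_add' := X.deriv_add
      map_smul' := X.deriv_smul }
    X.deriv_mul
  map_add' X Y := by
    ext f x
    exact map_add (mvfderiv (𝓡 n) f x) (X x) (Y x)
  map_smul' g X := by
    ext f x
    exact map_smul (mvfderiv (𝓡 n) f x) (g x) (X x)

/-- The Lie bracket of smooth vector fields. -/
def SmoothVectorField.bracket (X Y : SmoothVectorField n M) : SmoothVectorField n M :=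
  haveI : IsManifold (𝓡 n) (minSmoothness ℝ 2) M := by
    rw [minSmoothness_of_isRCLikeNormedField]; infer_instance
  haveI : IsManifold (𝓡 n) (((⊤ : ℕ∞) : WithTop ℕ∞) + 1) M :=
    inferInstanceAs (IsManifold (𝓡 n) ∞ M)
  ⟨fun x => VectorField.mlieBracket (𝓡 n) X Y x,
    ContDiff.mlieBracket_vectorField (m := ⊤) (n := ⊤) X.contMDiff Y.contMDiff (by simp)⟩

/-- The tangent Lie algebroid: the Lie bracket of vector fields with the identity anchor. -/
def tangentBracket (n M) [TopologicalSpace M] [ChartedSpace (EuclideanSpace ℝ (Fin n)) M]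
  [IsManifold (𝓡 n) ∞ M] : AnchoredBracket (SmoothFunction n M) (SmoothVectorField n M) where
  anchor := SmoothVectorField.toDerivation
  bracket := SmoothVectorField.bracket
  bracket_skew X Y := by
    ext x : 1
    exact VectorField.mlieBracket_swap_apply
  bracket_add X Y Z := by
    ext x : 1
    exact VectorField.mlieBracket_add_right Y.mdifferentiableAt Z.mdifferentiableAt
  bracket_smul X f Y := by
    ext x : 1
    refine (VectorField.mlieBracket_smul_right (f.mdiffAt x) Y.mdifferentiableAt).trans ?_
    exact add_comm _ _

/-- The differential `df` of a smooth function, `df(X) = X f`. -/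
def OneForm.d (f : SmoothFunction n M) : OneForm n M where
  toFun X := X.deriv f
  map_add' X Y := congrArg (fun D => D f) (SmoothVectorField.toDerivation.map_add X Y)
  map_smul' g X := congrArg (fun D => D f) (SmoothVectorField.toDerivation.map_smul g X)

/-- Local frames and coframes, cut off by a bump function. -/
theorem exists_local_frame [T2Space M] (x₀ : M) :
    ∃ (χ : SmoothFunction n M) (V : Fin n → SmoothVectorField n M) (c : Fin n → OneForm n M),
      (∀ᶠ x in nhds x₀, χ x = 1) ∧ (∀ X : SmoothVectorField n M, (χ * χ) • X = ∑ i, c i X • V i) ∧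
      ∀ X : SmoothVectorField n M, X x₀ = 0 → ∀ i, c i X x₀ = 0 := by
  let e := trivializationAt (EuclideanSpace ℝ (Fin n)) (TangentSpace (𝓡 n) : M → Type) x₀
  let b := (EuclideanSpace.basisFun (Fin n) ℝ).toBasis
  let ψ : SmoothBumpFunction (𝓡 n) x₀ := Classical.arbitrary _
  have hsub : tsupport ψ ⊆ e.baseSet := by
    simpa [e] using ψ.tsupport_subset_chartAt_source
  have hout : ∀ x ∉ e.baseSet, ψ x = 0 := fun x hx => by
    by_contra h
    exact hx (hsub (subset_tsupport _ h))
  let χ : SmoothFunction n M := ⟨ψ, ψ.contMDiff⟩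
  let V : Fin n → SmoothVectorField n M := fun i => ⟨(ψ : M → ℝ) • e.localFrame b i,
    ContMDiffOn.smul_section_of_tsupport ψ.contMDiff.contMDiffOn e.open_baseSet hsub
      (e.contMDiffOn_localFrame_baseSet ∞ b i)⟩
  have hc : ∀ (X : SmoothVectorField n M) (i : Fin n), ContMDiff (𝓡 n) 𝓘(ℝ, ℝ) ∞
      fun x => ψ x * e.localFrameCoeff (𝓡 n) b i x (X x) := by
    intro X i x
    by_cases hx : x ∈ e.baseSet
    · exact ψ.contMDiffAt.mul (contMDiffAt_localFrameCoeff b hx (X.contMDiff x) i)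
    · have hx' : x ∉ tsupport ψ := fun h => hx (hsub h)
      refine (contMDiffAt_const (c := (0 : ℝ))).congr_of_eventuallyEq ?_
      filter_upwards [(isClosed_tsupport ψ).isOpen_compl.mem_nhds hx'] with y hy
      have : ψ y = 0 := by
        by_contra h
        exact hy (subset_tsupport _ h)
      simp [this]
  let c : Fin n → OneForm n M := fun i =>
    { toFun X := ⟨_, hc X i⟩
      map_add' X Y := by
        ext x
        show ψ x * e.localFrameCoeff (𝓡 n) b i x (X x + Y x) = ψ x * _ + ψ x * _
        rw [map_add, mul_add]
      map_smul' f X := by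
        ext x
        show ψ x * e.localFrameCoeff (𝓡 n) b i x (f x • X x) = f x * (ψ x * _)
        rw [map_smul, smul_eq_mul]; ring }
  refine ⟨χ, V, c, ψ.eventuallyEq_one, fun X => ?_, fun X hX i => ?_⟩
  · ext x : 1
    have hsum : (∑ i, c i X • V i) x = ∑ i, (ψ x * e.localFrameCoeff (𝓡 n) b i x (X x)) •
        (ψ x • e.localFrame b i x) := by
      have := congrFun (map_sum (ContMDiffSection.coeAddHom (𝓡 n) (EuclideanSpace ℝ (Fin n)) ∞
        (TangentSpace (𝓡 n) : M → Type)) (fun i => c i X • V i) Finset.univ) x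
      rw [Finset.sum_apply] at this
      exact this
    rw [hsum]
    show (ψ x * ψ x) • X x = _
    by_cases hx : x ∈ e.baseSet
    · conv_lhs => rw [e.eq_sum_localFrameCoeff_smul (I := 𝓡 n) (b := b) (s := X) hx]
      rw [Finset.smul_sum]
      refine Finset.sum_congr rfl fun i _ => ?_
      simp only [smul_smul]
      congr 1
      ring
    · simp [hout x hx]
  · show ψ x₀ * e.localFrameCoeff (𝓡 n) b i x₀ (X x₀) = 0
    rw [hX, map_zero, mul_zero]

theorem OneForm.apply_eq_zero [T2Space M] (α : OneForm n M) {X : SmoothVectorField n M} {x : M} (h : X x = 0) :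
    α X x = 0 := by
  obtain ⟨χ, V, c, hχ, hV, hc⟩ := exists_local_frame (n := n) x
  have h1 : ((χ * χ) • α X) x = (∑ i, c i X • α (V i)) x := by
    rw [← map_smul, hV, map_sum]
    simp only [map_smul]
  have hx := hχ.self_of_nhds
  have h2 : (∑ i, c i X • α (V i)) x = 0 := by
    have : (∑ i, c i X • α (V i)) x = ∑ i, c i X x * α (V i) x := by
      have := congrFun (map_sum (ContMDiffMap.coeFnAddMonoidHom)
        (fun i => c i X • α (V i)) Finset.univ) x
      rw [Finset.sum_apply] at this
      exact this
    rw [this]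
    exact Finset.sum_eq_zero fun i _ => by rw [hc X h i, zero_mul]
  rw [h2] at h1
  have h3 : χ x * χ x * α X x = 0 := h1
  simpa [hx] using h3

theorem OneForm.apply_congr [T2Space M] (α : OneForm n M) {X Y : SmoothVectorField n M} {x : M}
    (h : X x = Y x) : α X x = α Y x := by
  have h1 : α (X - Y) x = 0 := α.apply_eq_zero (by
    show X x - Y x = 0
    rw [h, sub_self])
  rw [map_sub] at h1
  exact sub_eq_zero.1 h1

theorem SmoothVectorField.eq_zero_of_forall [T2Space M] (X : SmoothVectorField n M) (x : M) (h : ∀ α : OneForm n M, α X x = 0) :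
    X x = 0 := by
  obtain ⟨χ, V, c, hχ, hV, hc⟩ := exists_local_frame (n := n) x
  have hx := hχ.self_of_nhds
  have h1 : ((χ * χ) • X) x = ∑ i, c i X x • V i x := by
    rw [hV]
    have := congrFun (map_sum (ContMDiffSection.coeAddHom (𝓡 n) (EuclideanSpace ℝ (Fin n)) ∞
        (TangentSpace (𝓡 n) : M → Type)) (fun i => c i X • V i) Finset.univ) x
    rw [Finset.sum_apply] at this
    exact this
  have h2 : (χ x * χ x) • X x = ∑ i, c i X x • V i x := h1
  simpa [hx, h] using h2

/-- Sections of the double dual are vector fields. -/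
theorem existsUnique_vectorField [T2Space M] (Φ : OneForm n M →ₗ[SmoothFunction n M] SmoothFunction n M) :
    ∃! X : SmoothVectorField n M, ∀ α : OneForm n M, α X = Φ α := by
  have hloc : ∀ x₀ : M, ∃ X : SmoothVectorField n M, ∀ᶠ x in nhds x₀, ∀ α : OneForm n M, α X x = Φ α x := by
    intro x₀
    obtain ⟨χ, V, c, hχ, hV, -⟩ := exists_local_frame (n := n) x₀
    refine ⟨∑ i, Φ (c i) • V i, hχ.mono fun x hx α => ?_⟩
    have h1 : (χ * χ) • α = ∑ i, α (V i) • c i := by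
      ext1 X
      rw [LinearMap.smul_apply, ← map_smul, hV, map_sum, LinearMap.sum_apply]
      refine Finset.sum_congr rfl fun i _ => ?_
      rw [map_smul, LinearMap.smul_apply, smul_eq_mul, smul_eq_mul, mul_comm]
    have h2 : α (∑ i, Φ (c i) • V i) = (χ * χ) • Φ α := by
      rw [← map_smul, h1, map_sum, map_sum]
      refine Finset.sum_congr rfl fun i _ => ?_
      rw [map_smul, map_smul, smul_eq_mul, smul_eq_mul, mul_comm]
    rw [h2]
    show χ x * χ x * Φ α x = Φ α x
    rw [hx, one_mul, one_mul]
  choose X hX using hloc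
  have hsep : ∀ (Y Z : SmoothVectorField n M) (x : M), (∀ α : OneForm n M, α Y x = α Z x) → Y x = Z x := by
    intro Y Z x h
    have : (Y - Z) x = 0 := (Y - Z).eq_zero_of_forall x fun α => by
      rw [map_sub]
      exact sub_eq_zero.2 (h α)
    exact sub_eq_zero.1 this
  have hev : ∀ x₀, ∀ᶠ x in nhds x₀, X x x = X x₀ x := fun x₀ =>
    (hX x₀).mono fun x hx => hsep _ _ x fun α => ((hX x).self_of_nhds α).trans (hx α).symm
  let Y : SmoothVectorField n M := ⟨fun x => X x x, fun x₀ => by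
    refine ((X x₀).contMDiff x₀).congr_of_eventuallyEq ((hev x₀).mono fun x hx => ?_)
    simp only [hx]⟩
  have hY : ∀ α : OneForm n M, α Y = Φ α := fun α => by
    ext x
    exact (α.apply_congr (X := Y) (Y := X x) rfl).trans ((hX x).self_of_nhds α)
  refine ⟨Y, hY, fun Z hZ => ?_⟩
  ext x : 1
  exact hsep _ _ x fun α => by rw [hZ, hY]

theorem SmoothVectorField.deriv_pullback (f : SmoothFunction n M) (Z : (x : M) → TangentSpace (𝓡 n) x) (x : M)
    {y : EuclideanSpace ℝ (Fin n)} (hy : y ∈ (extChartAt (𝓡 n) x).target) :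
    mvfderiv (𝓡 n) f ((extChartAt (𝓡 n) x).symm y) (Z ((extChartAt (𝓡 n) x).symm y)) =
      fderiv ℝ (f ∘ (extChartAt (𝓡 n) x).symm) y
        (VectorField.mpullbackWithin 𝓘(ℝ, EuclideanSpace ℝ (Fin n)) (𝓡 n)
          (extChartAt (𝓡 n) x).symm Z (Set.range (𝓡 n)) y) := by
  have hinv := isInvertible_mfderivWithin_extChartAt_symm (I := 𝓡 n) (x := x) hy
  have h1 : mvfderivWithin 𝓘(ℝ, EuclideanSpace ℝ (Fin n)) (f ∘ (extChartAt (𝓡 n) x).symm)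
      (Set.range (𝓡 n)) y = _ :=
    mvfderiv_comp_mfderivWithin y (f.mdiffAt _)
      ((mdifferentiableWithinAt_of_isInvertible_mfderivWithin hinv))
      ((𝓡 n).uniqueMDiffOn y (extChartAt_target_subset_range x hy))
  have h2 : fderiv ℝ (f ∘ (extChartAt (𝓡 n) x).symm) y =
      mvfderivWithin 𝓘(ℝ, EuclideanSpace ℝ (Fin n)) (f ∘ (extChartAt (𝓡 n) x).symm)
      (Set.range (𝓡 n)) y := by
    rw [ModelWithCorners.range_eq_univ, mvfderivWithin_univ]
    exact mfderiv_eq_fderiv.symm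
  rw [h2, h1, VectorField.mpullbackWithin_apply]
  obtain ⟨e, he⟩ := hinv
  have h3 : ∀ v, mfderivWithin 𝓘(ℝ, EuclideanSpace ℝ (Fin n)) (𝓡 n) (extChartAt (𝓡 n) x).symm
      (Set.range (𝓡 n)) y ((mfderivWithin 𝓘(ℝ, EuclideanSpace ℝ (Fin n)) (𝓡 n)
        (extChartAt (𝓡 n) x).symm (Set.range (𝓡 n)) y).inverse v) = v := by
    intro v
    rw [← he]
    refine Eq.trans ?_ (e.apply_symm_apply v)
    exact congrArg (fun T => e (T v)) (ContinuousLinearMap.inverse_equiv e)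
  exact congrArg (mvfderiv (𝓡 n) f ((extChartAt (𝓡 n) x).symm y)) (h3 _).symm

/-- `[X, Y] f = X (Y f) - Y (X f)`. -/
theorem SmoothVectorField.deriv_bracket (X Y : SmoothVectorField n M) (f : SmoothFunction n M) :
    (X.bracket Y).deriv f = X.deriv (Y.deriv f) - Y.deriv (X.deriv f) := by
  ext x
  let φ := extChartAt (𝓡 n) x
  let hat : SmoothVectorField n M → EuclideanSpace ℝ (Fin n) → EuclideanSpace ℝ (Fin n) := fun Z => VectorField.mpullbackWithin 𝓘(ℝ, EuclideanSpace ℝ (Fin n)) (𝓡 n)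
          (extChartAt (𝓡 n) x).symm Z (Set.range (𝓡 n))
  let F : EuclideanSpace ℝ (Fin n) → ℝ := f ∘ φ.symm
  have hp : φ x ∈ φ.target := mem_extChartAt_target x
  have hsymm : φ.symm (φ x) = x := extChartAt_to_inv x
  have hopen : φ.target ∈ nhds (φ x) := extChartAt_target_mem_nhds x
  have hF : ContDiffAt ℝ ∞ F (φ x) := by
    have h1 := (f.contMDiff x)
    have h2 := (contMDiffAt_iff.1 h1).2
    rw [ModelWithCorners.range_eq_univ] at h2
    exact h2
  have hF2 : ContDiffAt ℝ 2 F (φ x) := hF.of_le (WithTop.coe_le_coe.2 le_top)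
  have hF' : DifferentiableAt ℝ (fderiv ℝ F) (φ x) :=
    (hF2.fderiv_right (m := 1) (by norm_num)).differentiableAt (by norm_num)
  have hhat : ∀ Z : SmoothVectorField n M, DifferentiableAt ℝ (hat Z) (φ x) := fun Z => by
    have := (Z.mdifferentiableAt (x := x)).mdifferentiableWithinAt (s := Set.univ)
      |>.differentiableWithinAt_mpullbackWithin_vectorField
    rw [Set.preimage_univ, Set.univ_inter] at this
    exact this.differentiableAt (by rw [ModelWithCorners.range_eq_univ]; exact Filter.univ_mem)
  have hd : ∀ (Z W : SmoothVectorField n M), W.deriv (Z.deriv f) x =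
      fderiv ℝ (fderiv ℝ F) (φ x) (hat W (φ x)) (hat Z (φ x)) +
        fderiv ℝ F (φ x) (fderiv ℝ (hat Z) (φ x) (hat W (φ x))) := by
    intro Z W
    have h1 := SmoothVectorField.deriv_pullback (Z.deriv f) W x hp
    have h2 : (Z.deriv f ∘ φ.symm) =ᶠ[nhds (φ x)] fun y => fderiv ℝ F y (hat Z y) := by
      filter_upwards [hopen] with y hy
      exact SmoothVectorField.deriv_pullback f Z x hy
    have h3 : W.deriv (Z.deriv f) x = fderiv ℝ (Z.deriv f ∘ φ.symm) (φ x) (hat W (φ x)) := by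
      rw [← h1]
      change _ = mvfderiv (𝓡 n) (Z.deriv f) (φ.symm (φ x)) (W (φ.symm (φ x)))
      rw [hsymm]
      rfl
    rw [h3, h2.fderiv_eq, fderiv_clm_apply hF' (hhat Z)]
    exact add_comm _ _
  have hs := (hF2.isSymmSndFDerivAt (by simp)) (hat X (φ x)) (hat Y (φ x))
  have hb : (X.bracket Y).deriv f x =
      fderiv ℝ F (φ x) (VectorField.lieBracket ℝ (hat X) (hat Y) (φ x)) := by
    have hinv := isInvertible_mfderiv_extChartAt (I := 𝓡 n) (mem_extChartAt_source (I := 𝓡 n) x)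
    obtain ⟨e, he⟩ := hinv
    have h1 : ∀ v, mfderiv (𝓡 n) 𝓘(ℝ, EuclideanSpace ℝ (Fin n)) φ x
        ((mfderiv (𝓡 n) 𝓘(ℝ, EuclideanSpace ℝ (Fin n)) φ x).inverse v) = v := by
      intro v
      rw [← he]
      refine Eq.trans ?_ (e.apply_symm_apply v)
      exact congrArg (fun T => e (T v)) (ContinuousLinearMap.inverse_equiv e)
    have h2 : (F ∘ φ) =ᶠ[nhds x] f := by
      filter_upwards [extChartAt_source_mem_nhds (I := 𝓡 n) x] with y hy
      exact congrArg f (φ.left_inv hy)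
    have h3 : ∀ v, mvfderiv (𝓡 n) f x v =
        fderiv ℝ F (φ x) (mfderiv (𝓡 n) 𝓘(ℝ, EuclideanSpace ℝ (Fin n)) φ x v) := by
      intro v
      have h4 : mfderiv (𝓡 n) 𝓘(ℝ, ℝ) (F ∘ φ) x = mfderiv (𝓡 n) 𝓘(ℝ, ℝ) f x := h2.mfderiv_eq
      have h5 : mfderiv (𝓡 n) 𝓘(ℝ, ℝ) (F ∘ φ) x = _ :=
        mfderiv_comp x (hF2.differentiableAt (by norm_num)).mdifferentiableAt
          (mdifferentiableAt_extChartAt (mem_chart_source _ x))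
      rw [mfderiv_eq_fderiv] at h5
      exact congrArg (fun T => T v) (h4.symm.trans h5)
    have h4 : (X.bracket Y).deriv f x = fderiv ℝ F (φ x) (VectorField.lieBracketWithin ℝ (hat X)
        (hat Y) (φ.symm ⁻¹' Set.univ ∩ Set.range (𝓡 n)) (φ x)) :=
      (h3 _).trans (congrArg _ (h1 _))
    rw [h4, Set.preimage_univ, Set.univ_inter, ModelWithCorners.range_eq_univ,
      VectorField.lieBracketWithin_univ]
  rw [hb]
  show _ = X.deriv (Y.deriv f) x - Y.deriv (X.deriv f) x
  rw [hd, hd, VectorField.lieBracket_eq, map_sub, hs]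
  ring

/-- Contraction of a bivector field with a `1`-form in the first slot. -/
def MultivectorField.contract (P : MultivectorField n M 2) (α : OneForm n M) :
    OneForm n M →ₗ[SmoothFunction n M] SmoothFunction n M where
  toFun β := P ![α, β]
  map_add' β γ := congrArg (fun g => g ![]) ((P.curryLeft α).curryLeft.map_add β γ)
  map_smul' f β := congrArg (fun g => g ![]) ((P.curryLeft α).curryLeft.map_smul f β)

theorem MultivectorField.pair_add (P : MultivectorField n M 2) (α α' β : OneForm n M) :
    P ![α + α', β] = P ![α, β] + P ![α', β] :=
  congrArg (fun g => g ![β]) (P.curryLeft.map_add α α')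

theorem MultivectorField.pair_smul (P : MultivectorField n M 2) (f : SmoothFunction n M) (α β : OneForm n M) :
    P ![f • α, β] = f * P ![α, β] :=
  congrArg (fun g => g ![β]) (P.curryLeft.map_smul f α)

theorem MultivectorField.pair_skew (P : MultivectorField n M 2) (α β : OneForm n M) :
    P ![α, β] = - P ![β, α] := by
  have h := P.map_swap ![α, β] (i := 0) (j := 1) (by simp)
  rw [← neg_eq_iff_eq_neg, ← h]
  congr 1
  ext i : 1
  fin_cases i <;> rfl

variable [T2Space M]

/-- The map `P♯ : Γ(T*M) → Γ(TM)` of a bivector field `P`, determined by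
`⟨β, P♯ α⟩ = P(α, β)`, see `apply_sharp`. -/
def sharp (P : MultivectorField n M 2) : OneForm n M →ₗ[SmoothFunction n M] SmoothVectorField n M where
  toFun α := (existsUnique_vectorField (P.contract α)).choose
  map_add' α α' := by
    refine ((existsUnique_vectorField (P.contract (α + α'))).choose_spec.2 _ fun β => ?_).symm
    rw [map_add, (existsUnique_vectorField (P.contract α)).choose_spec.1,
      (existsUnique_vectorField (P.contract α')).choose_spec.1]
    exact (P.pair_add α α' β).symm
  map_smul' f α := by
    refine ((existsUnique_vectorField (P.contract (f • α))).choose_spec.2 _ fun β => ?_).symm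
    rw [RingHom.id_apply, map_smul, (existsUnique_vectorField (P.contract α)).choose_spec.1]
    exact (P.pair_smul f α β).symm

theorem apply_sharp (P : MultivectorField n M 2) (α β : OneForm n M) : β (sharp P α) = P ![α, β] :=
  (existsUnique_vectorField (P.contract α)).choose_spec.1 β

/-- The Lie derivative of a `1`-form, `(L_X β)(Z) = X (β(Z)) - β([X, Z])`. -/
def lieDeriv (X : SmoothVectorField n M) (β : OneForm n M) : OneForm n M where
  toFun Z := X.deriv (β Z) - β (X.bracket Z)
  map_add' Y Z := by
    rw [show X.bracket (Y + Z) = X.bracket Y + X.bracket Z from (tangentBracket n M).bracket_add X Y Z,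
      map_add, map_add, SmoothVectorField.deriv_add]
    ring
  map_smul' f Z := by
    rw [show X.bracket (f • Z) = f • X.bracket Z + X.deriv f • Z from
      (tangentBracket n M).bracket_smul X f Z, map_add, map_smul, map_smul, map_smul, smul_eq_mul,
      SmoothVectorField.deriv_mul]
    simp only [smul_eq_mul, RingHom.id_apply]
    ring

/-- The `1`-form `φ(X, Y, ·)`. -/
def DiffForm.contract₂ (φ : DiffForm n M 3) (X Y : SmoothVectorField n M) : OneForm n M where
  toFun Z := φ ![X, Y, Z]
  map_add' Z Z' :=
    congrArg (fun g => g ![]) (((φ.curryLeft X).curryLeft Y).curryLeft.map_add Z Z')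
  map_smul' f Z :=
    congrArg (fun g => g ![]) (((φ.curryLeft X).curryLeft Y).curryLeft.map_smul f Z)

/-- The Koszul bracket `{α, β} = L_{P♯ α} β - L_{P♯ β} α - d(P(α, β))`. -/
def koszulBracket (P : MultivectorField n M 2) (α β : OneForm n M) : OneForm n M :=
  lieDeriv (sharp P α) β - lieDeriv (sharp P β) α - OneForm.d (P ![α, β])

/-- The twisted bracket `{α, β}^φ = {α, β} + φ(P♯ α, P♯ β, ·)`. -/
def twistedBracket (P : MultivectorField n M 2) (φ : DiffForm n M 3) (α β : OneForm n M) : OneForm n M :=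
  koszulBracket P α β + φ.contract₂ (sharp P α) (sharp P β)

theorem twistedBracket_apply (P : MultivectorField n M 2) (φ : DiffForm n M 3) (α β : OneForm n M)
    (Z : SmoothVectorField n M) :
    twistedBracket P φ α β Z =
      ((sharp P α).deriv (β Z) - β ((sharp P α).bracket Z)) -
      ((sharp P β).deriv (α Z) - α ((sharp P β).bracket Z)) - Z.deriv (P ![α, β]) +
      φ ![sharp P α, sharp P β, Z] := rfl

/-- The twisted bracket on `Γ(T*M)` with the anchor `P♯ : Γ(T*M) → Γ(TM)`. -/
def cotangentBracket (P : MultivectorField n M 2) (φ : DiffForm n M 3) :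
    AnchoredBracket (SmoothFunction n M) (OneForm n M) where
  anchor := SmoothVectorField.toDerivation ∘ₗ sharp P
  bracket := twistedBracket P φ
  bracket_skew α β := by
    ext1 Z
    have h1 : OneForm.d (P ![α, β]) Z = - OneForm.d (P ![β, α]) Z := by
      rw [P.pair_skew α β]
      exact map_neg (SmoothVectorField.toDerivation Z) _
    have h2 : φ ![sharp P α, sharp P β, Z] = - φ ![sharp P β, sharp P α, Z] := by
      have h := φ.map_swap ![sharp P α, sharp P β, Z] (i := 0) (j := 1) (by simp)
      rw [← neg_eq_iff_eq_neg, ← h]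
      congr 1
      ext i : 1
      fin_cases i <;> rfl
    show (lieDeriv (sharp P α) β Z - lieDeriv (sharp P β) α Z - OneForm.d (P ![α, β]) Z) +
        φ ![sharp P α, sharp P β, Z] =
      - ((lieDeriv (sharp P β) α Z - lieDeriv (sharp P α) β Z - OneForm.d (P ![β, α]) Z) +
        φ ![sharp P β, sharp P α, Z])
    rw [h1, h2]
    ring
  bracket_add α β γ := by
    ext1 Z
    have hφ : φ ![sharp P α, sharp P β + sharp P γ, Z] =
        φ ![sharp P α, sharp P β, Z] + φ ![sharp P α, sharp P γ, Z] :=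
      congrArg (fun g => g ![Z]) ((φ.curryLeft (sharp P α)).curryLeft.map_add _ _)
    have hP : P ![α, β + γ] = P ![α, β] + P ![α, γ] := (P.contract α).map_add β γ
    have hb : (sharp P β + sharp P γ).bracket Z = (sharp P β).bracket Z + (sharp P γ).bracket Z :=
      (tangentBracket n M).bracket_add_left _ _ _
    have hd : (sharp P β + sharp P γ).deriv (α Z) =
        (sharp P β).deriv (α Z) + (sharp P γ).deriv (α Z) :=
      congrArg (fun D => D (α Z)) (SmoothVectorField.toDerivation.map_add (sharp P β) (sharp P γ))
    rw [LinearMap.add_apply]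
    simp only [twistedBracket_apply, map_add, hφ, hP, hb, hd, SmoothVectorField.deriv_add, LinearMap.add_apply]
    ring
  bracket_smul α f β := by
    ext1 Z
    have hφ : φ ![sharp P α, f • sharp P β, Z] = f * φ ![sharp P α, sharp P β, Z] :=
      congrArg (fun g => g ![Z]) ((φ.curryLeft (sharp P α)).curryLeft.map_smul f _)
    have hP : P ![α, f • β] = f * P ![α, β] := (P.contract α).map_smul f β
    have hb : (f • sharp P β).bracket Z = f • (sharp P β).bracket Z - Z.deriv f • sharp P β :=
      (tangentBracket n M).bracket_smul_left _ _ _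
    have hd : (f • sharp P β).deriv (α Z) = f * (sharp P β).deriv (α Z) :=
      congrArg (fun D => D (α Z)) (SmoothVectorField.toDerivation.map_smul f (sharp P β))
    have hs : α (sharp P β) = - P ![α, β] := by rw [apply_sharp, ← P.pair_skew β α]
    have ha : (SmoothVectorField.toDerivation ∘ₗ sharp P) α f = (sharp P α).deriv f := rfl
    rw [LinearMap.add_apply, ha]
    simp only [twistedBracket_apply, map_smul, map_sub, hφ, hP, hb, hd, hs, SmoothVectorField.deriv_mul,
      LinearMap.smul_apply, smul_eq_mul]
    ring

theorem SmoothVectorField.deriv_eq (X : SmoothVectorField n M) (f : SmoothFunction n M) : OneForm.d f X = X.deriv f := rfl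

/-- `{df, dg} = d{f, g}` with `{f, g} = P(df, dg)`. -/
theorem koszulBracket_d (P : MultivectorField n M 2) (f g : SmoothFunction n M) :
    koszulBracket P (OneForm.d f) (OneForm.d g) = OneForm.d (P ![OneForm.d f, OneForm.d g]) := by
  ext1 Z
  have h1 : (sharp P (OneForm.d f)).deriv g = P ![OneForm.d f, OneForm.d g] :=
    apply_sharp P (OneForm.d f) (OneForm.d g)
  have h2 : (sharp P (OneForm.d g)).deriv f = - P ![OneForm.d f, OneForm.d g] :=
    (apply_sharp P (OneForm.d g) (OneForm.d f)).trans (P.pair_skew _ _)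
  have hn : ∀ u, Z.deriv (-u) = - Z.deriv u := fun u => map_neg (SmoothVectorField.toDerivation Z) u
  have h0 := twistedBracket_apply P 0 (OneForm.d f) (OneForm.d g) Z
  rw [twistedBracket, LinearMap.add_apply] at h0
  have h3 : (0 : DiffForm n M 3).contract₂ (sharp P (OneForm.d f)) (sharp P (OneForm.d g)) Z = 0 :=
    rfl
  rw [h3, add_zero] at h0
  rw [h0]
  simp only [SmoothVectorField.deriv_eq, SmoothVectorField.deriv_bracket, h1, h2, hn, AlternatingMap.zero_apply]
  ring

/-- The Schouten bracket `[P, Q]` of two bivector fields, as a trivector field. It is given by the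
tensorial formula in `schouten_apply`. By `schouten_d` it is the trivector field whose value on
`(df, dg, dh)` is the cyclic sum of `P(df, d(Q(dg, dh))) + Q(df, d(P(dg, dh)))`; in coordinates,
`[P, Q]^{ijk}` is the cyclic sum of `P^{il} ∂_l Q^{jk} + Q^{il} ∂_l P^{jk}`. The sign is that of
`[X₁ ∧ X₂, Y₁ ∧ Y₂] = ∑ (-1)^(i+j) [X_i, Y_j] ∧ X_{3-i} ∧ Y_{3-j}`, so that
`½ [P, P](df, dg, dh) = {f, {g, h}} + {g, {h, f}} + {h, {f, g}}` for `{f, g} = P(df, dg)`. -/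
def schouten (P Q : MultivectorField n M 2) : MultivectorField n M 3 := (cotangentBracket P 0).diff Q

theorem schouten_apply (P Q : MultivectorField n M 2) (α β γ : OneForm n M) :
    schouten P Q ![α, β, γ] =
      (sharp P α).deriv (Q ![β, γ]) + (sharp P β).deriv (Q ![γ, α]) +
        (sharp P γ).deriv (Q ![α, β]) -
      (Q ![koszulBracket P α β, γ] + Q ![koszulBracket P β γ, α] +
        Q ![koszulBracket P γ α, β]) := by
  have hk : ∀ a b, (cotangentBracket P 0).bracket a b = koszulBracket P a b := fun a b =>
    add_zero (koszulBracket P a b)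
  have ha : ∀ a u, (cotangentBracket P 0).anchor a u = (sharp P a).deriv u := fun _ _ => rfl
  have hn : ∀ (X : SmoothVectorField n M) u, X.deriv (-u) = - X.deriv u := fun X u => map_neg (SmoothVectorField.toDerivation X) u
  have hl : ∀ a b, Q ![a, b] = Q (Fin.cons a ![b]) := fun a b => rfl
  have hI0 : Finset.Ici (0 : Fin 2) = {0, 1} := by decide
  have hI1 : Finset.Ici (1 : Fin 2) = {1} := by decide
  have e0 : ((0 : Fin 3).removeNth ![α, β, γ] : Fin 2 → OneForm n M) = ![β, γ] := by
    ext i : 1; fin_cases i <;> rfl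
  have e1 : ((1 : Fin 3).removeNth ![α, β, γ] : Fin 2 → OneForm n M) = ![α, γ] := by
    ext i : 1; fin_cases i <;> rfl
  have e2 : ((2 : Fin 3).removeNth ![α, β, γ] : Fin 2 → OneForm n M) = ![α, β] := by
    ext i : 1; fin_cases i <;> rfl
  have f0 : ∀ a b : OneForm n M, ((0 : Fin 2).removeNth ![a, b] : Fin 1 → OneForm n M) = ![b] := by
    intro a b; ext i : 1; fin_cases i; rfl
  have f1 : ∀ a b : OneForm n M, ((1 : Fin 2).removeNth ![a, b] : Fin 1 → OneForm n M) = ![a] := by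
    intro a b; ext i : 1; fin_cases i; rfl
  show AnchoredBracket.diffFun _ _ _ = _
  rw [AnchoredBracket.diffFun, AnchoredBracket.bracketSum, Fin.sum_univ_three, Fin.sum_univ_two,
    hI0, hI1, Finset.sum_pair (by decide), Finset.sum_singleton]
  simp only [hk, ha, Fin.castSucc_zero, Fin.castSucc_one, Fin.succ_zero_eq_one,
    Fin.succ_one_eq_two, e0, e1, e2, f0, f1, ← hl, Fin.val_zero, Fin.val_one, Fin.val_two]
  have k1 : koszulBracket P γ α = - koszulBracket P α γ := by
    rw [← hk, ← hk]; exact (cotangentBracket P 0).bracket_skew γ α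
  have k2 : Q ![koszulBracket P γ α, β] = - Q ![koszulBracket P α γ, β] := by
    rw [k1]; exact congrArg (fun g => g ![β]) (Q.curryLeft.map_neg _)
  rw [k2, Q.pair_skew γ α, hn]
  simp
  ring

theorem schouten_d (P Q : MultivectorField n M 2) (f g h : SmoothFunction n M) :
    schouten P Q ![OneForm.d f, OneForm.d g, OneForm.d h] =
      P ![OneForm.d f, OneForm.d (Q ![OneForm.d g, OneForm.d h])] +
      P ![OneForm.d g, OneForm.d (Q ![OneForm.d h, OneForm.d f])] +
      P ![OneForm.d h, OneForm.d (Q ![OneForm.d f, OneForm.d g])] +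
      (Q ![OneForm.d f, OneForm.d (P ![OneForm.d g, OneForm.d h])] +
      Q ![OneForm.d g, OneForm.d (P ![OneForm.d h, OneForm.d f])] +
      Q ![OneForm.d h, OneForm.d (P ![OneForm.d f, OneForm.d g])]) := by
  have h1 : ∀ u v : SmoothFunction n M, (sharp P (OneForm.d u)).deriv v =
      P ![OneForm.d u, OneForm.d v] := fun u v => apply_sharp P (OneForm.d u) (OneForm.d v)
  rw [schouten_apply]
  simp only [koszulBracket_d, h1]
  rw [Q.pair_skew (OneForm.d (P ![OneForm.d f, OneForm.d g])),
    Q.pair_skew (OneForm.d (P ![OneForm.d g, OneForm.d h])),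
    Q.pair_skew (OneForm.d (P ![OneForm.d h, OneForm.d f]))]
  ring

/-- The extension of `P♯` to a map `Γ(⋀^k T*M) → Γ(⋀^k TM)`,
`(P♯ η)(α_1, …, α_k) = (-1)^k η(P♯ α_1, …, P♯ α_k)`; in degree zero it is the identity of
`C^∞(M)`. -/
def sharpForm (P : MultivectorField n M 2) {k : ℕ} (η : DiffForm n M k) : MultivectorField n M k :=
  (-1 : ℝ) ^ k • η.compLinearMap (sharp P)

/-- The exterior derivative `d` of differential forms. -/
def extDer {k : ℕ} (η : DiffForm n M k) : DiffForm n M (k + 1) := (tangentBracket n M).diff η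

/-- The operator `∂_φ` on multivector fields, the exterior derivative determined by the bracket
`{·, ·}^φ` and the anchor `P♯`. -/
def lichDer (P : MultivectorField n M 2) (φ : DiffForm n M 3) {k : ℕ} (Q : MultivectorField n M k) :
    MultivectorField n M (k + 1) := (cotangentBracket P φ).diff Q

/-- `(M, P, φ)` is a twisted Poisson manifold: `dφ = 0` and `½ [P, P] = P♯(φ)`. -/
structure IsTwistedPoisson (P : MultivectorField n M 2) (φ : DiffForm n M 3) : Prop where
  closed : extDer φ = 0
  half_schouten : (1 / 2 : ℝ) • schouten P P = sharpForm P φ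

/-- `P` is nondegenerate: at every point `x`, the bilinear form `P_x` on `T*_x M` is nondegenerate,
that is, a `1`-form `α` with `P_x(α_x, β_x) = 0` for all `β` vanishes at `x`. -/
def IsNondegenerate (P : MultivectorField n M 2) : Prop :=
  ∀ (x : M) (α : OneForm n M), (∀ β : OneForm n M, P ![α, β] x = 0) → ∀ X : SmoothVectorField n M, α X x = 0

/-- The de Rham cohomology `H^k_dR(M, ℝ)`. -/
abbrev DeRhamCohomology (n : ℕ) (M : Type*) [TopologicalSpace M]
    [ChartedSpace (EuclideanSpace ℝ (Fin n)) M] [IsManifold (𝓡 n) ∞ M] (k : ℕ) : Type _ :=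
  (tangentBracket n M).Cohomology k

/-- The Lichnerowicz-twisted Poisson cohomology `H^k_{L-tP}(M, P, φ)`. -/
abbrev LtPCohomology (P : MultivectorField n M 2) (φ : DiffForm n M 3) (k : ℕ) : Type _ :=
  (cotangentBracket P φ).Cohomology k

/-- The de Rham class of a closed form. -/
def deRhamClass {k : ℕ} (η : DiffForm n M k) (hη : extDer η = 0) : DeRhamCohomology n M k :=
  (tangentBracket n M).cohomologyClass η hη

/-- The class `[Q]^φ` of a multivector field with `∂_φ Q = 0`. -/
def ltpClass (P : MultivectorField n M 2) (φ : DiffForm n M 3) {k : ℕ} (Q : MultivectorField n M k)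
    (hQ : lichDer P φ Q = 0) : LtPCohomology P φ k :=
  (cotangentBracket P φ).cohomologyClass Q hQ

end TwistedPoisson

end

/-! Everything rests on one identity: on a twisted Poisson manifold `P♯` carries the twisted bracket
of one-forms to the Lie bracket of vector fields (`IsTwistedPoisson.bracket_sharp`). Write X_α for
P♯α, S for the cyclic sum of X_α(P(β, γ)) and T for the cyclic sum of γ([X_α, X_β]). Expanding the
Koszul bracket gives P({α, β}, γ) = S - T + γ([X_α, X_β]). Hence [P, P](α, β, γ) = S - (3S - 2T) =
2(T - S), and the twisted Poisson equation says T - S = -φ(X_α, X_β, X_γ). This is exactly the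
φ-term added to the Koszul bracket, once skew-symmetry of P has produced its sign.

Both differentials are given by the same formula in terms of an anchor and a bracket, and the anchor
of the cotangent bracket is the derivation along P♯α. Pullback of forms along P♯ therefore commutes
with the differentials term by term. The factor (-1)^k in P♯ on k-forms turns this into ∂_φ P♯ = -P♯
d. Such a map preserves cocycles and coboundaries, the sign being absorbed in the primitive, so it
descends to cohomology.

In the nondegenerate case P♯ has to be inverted on global sections, although nondegeneracy is a
condition at each point. Injectivity is immediate. For surjectivity, Cramer's rule in a cut-off
local frame solves P♯θ = fX with f nonzero at a prescribed point, and injectivity makes the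
quotients θ/f agree on overlaps, so they glue (`sharp_surjective`). Then P♯ is bijective on forms of
every degree, and an anticommuting bijection of complexes is bijective on cohomology. -/

noncomputable section

namespace TwistedPoisson

/-! ### Induced maps on subquotients. -/

namespace Subquotient
variable {V V' : Type*} [AddCommGroup V] [Module ℝ V] [AddCommGroup V'] [Module ℝ V']
  {Z B : Submodule ℝ V} {Z' B' : Submodule ℝ V'}

/-- The map of subquotients induced by a linear map. -/
def map (f : V →ₗ[ℝ] V') (hZ : ∀ v ∈ Z, f v ∈ Z') (hB : ∀ v ∈ B, f v ∈ B') :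
    Subquotient Z B →ₗ[ℝ] Subquotient Z' B' :=
  Submodule.mapQ (B.submoduleOf Z) (B'.submoduleOf Z') (f.restrict hZ) fun v hv => hB v hv

/-- Reflecting `B` gives injectivity; lifting a representative through `f` and reflecting `Z` gives
surjectivity. -/
theorem map_bijective (f : V →ₗ[ℝ] V') (hZ : ∀ v ∈ Z, f v ∈ Z') (hB : ∀ v ∈ B, f v ∈ B')
    (hf : Function.Surjective f) (hZ' : ∀ v, f v ∈ Z' → v ∈ Z) (hB' : ∀ v, f v ∈ B' → v ∈ B) :
    Function.Bijective (map f hZ hB) := by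
  constructor
  · refine (injective_iff_map_eq_zero _).2 fun a ha => ?_
    obtain ⟨v, rfl⟩ := Submodule.Quotient.mk_surjective _ a
    have h1 : f v ∈ B' :=
      (Submodule.Quotient.mk_eq_zero (B'.submoduleOf Z') (x := f.restrict hZ v)).1 ha
    exact (Submodule.Quotient.mk_eq_zero (B.submoduleOf Z)).2 (hB' v h1)
  · intro b
    obtain ⟨⟨w, hw⟩, rfl⟩ := Submodule.Quotient.mk_surjective _ b
    obtain ⟨v, rfl⟩ := hf w
    exact ⟨Submodule.Quotient.mk ⟨v, hZ' v hw⟩, rfl⟩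

end Subquotient

/-! ### Naturality of the exterior derivative. -/

namespace AnchoredBracket
variable {A L L' : Type*} [CommRing A] [Algebra ℝ A] [AddCommGroup L] [Module A L]
  [AddCommGroup L'] [Module A L']

/-- The exterior derivative commutes with pullback along a morphism of anchored brackets. -/
theorem diffFun_compLinearMap (B : AnchoredBracket A L) (B' : AnchoredBracket A L')
    (S : L →ₗ[A] L') (ha : ∀ X, B'.anchor (S X) = B.anchor X)
    (hb : ∀ X Y, B'.bracket (S X) (S Y) = S (B.bracket X Y)) {k : ℕ}
    (P : L' [⋀^Fin k]→ₗ[A] A) (α : Fin (k + 1) → L) :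
    B.diffFun (P.compLinearMap S) α = B'.diffFun P fun i => S (α i) := by
  have hS : B.bracketSum (P.compLinearMap S) α = B'.bracketSum P fun i => S (α i) := by
    cases k with
    | zero => rfl
    | succ k =>
      refine Finset.sum_congr rfl fun i _ => Finset.sum_congr rfl fun j _ => ?_
      rw [AlternatingMap.compLinearMap_apply, hb]
      congr 2
      -- Applying `S` entrywise to the tuple headed by the bracket gives the corresponding tuple in
      -- `L'`; head and tail are compared separately.
      funext l
      refine Fin.cases ?_ (fun l => ?_) l <;> rfl
  rw [diffFun, diffFun, hS]
  congr 1
  refine Finset.sum_congr rfl fun i _ => ?_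
  rw [ha]
  rfl

end AnchoredBracket

/-! ### Finite sums of functions, fields and forms. -/

variable {n : ℕ} {M : Type*} [TopologicalSpace M] [ChartedSpace (EuclideanSpace ℝ (Fin n)) M]
  [IsManifold (𝓡 n) ∞ M]

theorem SmoothFunction.sum_apply {ι : Type*} (s : Finset ι) (f : ι → SmoothFunction n M) (x : M) :
    (∑ i ∈ s, f i) x = ∑ i ∈ s, f i x := by
  have := congrFun (map_sum (ContMDiffMap.coeFnAddMonoidHom) f s) x
  rwa [Finset.sum_apply] at this

theorem SmoothVectorField.sum_apply {ι : Type*} (s : Finset ι) (X : ι → SmoothVectorField n M)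
    (x : M) : (∑ i ∈ s, X i) x = ∑ i ∈ s, X i x := by
  have := congrFun (map_sum (ContMDiffSection.coeAddHom (𝓡 n) (EuclideanSpace ℝ (Fin n)) ∞
    (TangentSpace (𝓡 n) : M → Type)) X s) x
  rwa [Finset.sum_apply] at this

theorem MultivectorField.pair_sum {ι : Type*} (P : MultivectorField n M 2) (s : Finset ι)
    (α : OneForm n M) (β : ι → OneForm n M) :
    P ![α, ∑ i ∈ s, β i] = ∑ i ∈ s, P ![α, β i] :=
  map_sum (P.contract α) β s

/-! ### The anchor `P♯` as a morphism of brackets. -/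

variable [T2Space M]

/-- Skew-symmetry of `P` makes `P♯` skew-adjoint. This serves to evaluate `P♯` of a one-form that is
known only through its values on vector fields. -/
theorem OneForm.apply_sharp_swap (P : MultivectorField n M 2) (α β : OneForm n M) :
    α (sharp P β) = -β (sharp P α) := by
  rw [apply_sharp, apply_sharp, P.pair_skew]

/-- Global one-forms, obtained by cutting off local coframes, separate tangent vectors at each
point. -/
theorem SmoothVectorField.ext_of_forall {X Y : SmoothVectorField n M}
    (h : ∀ α : OneForm n M, α X = α Y) : X = Y := by
  have : ∀ x, (X - Y) x = 0 := fun x => (X - Y).eq_zero_of_forall x fun α => by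
    rw [map_sub, h, sub_self]; rfl
  ext x : 1
  exact sub_eq_zero.1 (this x)

/-- `P({α, β}, γ)` for the Koszul bracket `{α, β}`, expressed through derivatives of `P` and Lie brackets. -/
theorem pair_koszulBracket (P : MultivectorField n M 2) (α β γ : OneForm n M) :
    P ![koszulBracket P α β, γ] =
      (sharp P α).deriv (P ![β, γ]) + (sharp P β).deriv (P ![γ, α]) +
        (sharp P γ).deriv (P ![α, β]) - β ((sharp P γ).bracket (sharp P α)) -
        α ((sharp P β).bracket (sharp P γ)) := by
  have hn : ∀ (X : SmoothVectorField n M) u, X.deriv (-u) = - X.deriv u :=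
    fun X u => map_neg (SmoothVectorField.toDerivation X) u
  -- The Koszul bracket is the twisted bracket for the zero three-form. It is evaluated at P♯γ
  -- because P({α, β}, γ) = -{α, β}(P♯γ).
  have h0 := twistedBracket_apply P 0 α β (sharp P γ)
  rw [twistedBracket, LinearMap.add_apply,
    show (0 : DiffForm n M 3).contract₂ (sharp P α) (sharp P β) (sharp P γ) = 0 from rfl,
    AlternatingMap.zero_apply, add_zero, add_zero] at h0
  have hs : (sharp P α).bracket (sharp P γ) = -(sharp P γ).bracket (sharp P α) :=
    (tangentBracket n M).bracket_skew _ _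
  rw [← apply_sharp, OneForm.apply_sharp_swap, h0, hs, map_neg, apply_sharp, apply_sharp,
    P.pair_skew γ β, hn]
  ring

/-- On a twisted Poisson manifold, the anchor is a morphism of brackets. -/
theorem IsTwistedPoisson.bracket_sharp {P : MultivectorField n M 2} {φ : DiffForm n M 3}
    (h : IsTwistedPoisson P φ) (α β : OneForm n M) :
    (sharp P α).bracket (sharp P β) = sharp P (twistedBracket P φ α β) := by
  refine SmoothVectorField.ext_of_forall fun γ => ?_
  have h1 := congrArg (fun T => T ![α, β, γ]) h.half_schouten
  have h2 : sharpForm P φ ![α, β, γ] = -φ ![sharp P α, sharp P β, sharp P γ] := by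
    have : (fun i => sharp P (![α, β, γ] i)) = ![sharp P α, sharp P β, sharp P γ] := by
      funext i
      fin_cases i <;> rfl
    rw [sharpForm, AlternatingMap.smul_apply, AlternatingMap.compLinearMap_apply]
    change (-1 : ℝ) ^ 3 • φ (fun i => sharp P (![α, β, γ] i)) = _
    rw [this]
    norm_num
  -- Doubling clears the ½; after the three Koszul terms are expanded, this reads 2(T - S) =
  -- -2φ(P♯α, P♯β, P♯γ), with S and T the cyclic sums of derivatives and of Lie bracket terms.
  have h3 : (2 : ℝ) • ((1 / 2 : ℝ) • schouten P P ![α, β, γ]) =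
      (2 : ℝ) • (-φ ![sharp P α, sharp P β, sharp P γ]) := by
    rw [← h2]
    exact congrArg ((2 : ℝ) • ·) h1
  rw [smul_smul, show (2 : ℝ) * (1 / 2) = 1 by norm_num, one_smul, two_smul, schouten_apply,
    pair_koszulBracket, pair_koszulBracket, pair_koszulBracket] at h3
  have h4 : γ (sharp P (twistedBracket P φ α β)) =
      P ![koszulBracket P α β, γ] - φ ![sharp P α, sharp P β, sharp P γ] := by
    have h5 : (φ.contract₂ (sharp P α) (sharp P β)) (sharp P γ) =
      φ ![sharp P α, sharp P β, sharp P γ] := rfl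
    rw [twistedBracket, map_add, map_add, apply_sharp, OneForm.apply_sharp_swap P γ, h5]
    ring
  rw [h4, pair_koszulBracket]
  -- The relation between S and T is available only doubled, so the target is proved doubled and the
  -- real scalar 2 is cancelled afterwards.
  have h6 : (2 : ℝ) • γ ((sharp P α).bracket (sharp P β)) = (2 : ℝ) •
      ((sharp P α).deriv (P ![β, γ]) + (sharp P β).deriv (P ![γ, α]) +
        (sharp P γ).deriv (P ![α, β]) - β ((sharp P γ).bracket (sharp P α)) -
        α ((sharp P β).bracket (sharp P γ)) - φ ![sharp P α, sharp P β, sharp P γ]) := by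
    rw [two_smul, two_smul]
    linear_combination h3
  exact smul_right_injective _ (two_ne_zero (α := ℝ)) h6

/-- `∂_φ (P♯ η) = - P♯ (dη)`. -/
theorem IsTwistedPoisson.lichDer_sharpForm {P : MultivectorField n M 2} {φ : DiffForm n M 3}
    (h : IsTwistedPoisson P φ) {k : ℕ} (η : DiffForm n M k) :
    lichDer P φ (sharpForm P η) = -sharpForm P (extDer η) := by
  ext1 α
  have h1 : lichDer P φ (sharpForm P η) α =
      (-1 : ℝ) ^ k • (tangentBracket n M).diffFun η fun i => sharp P (α i) := by
    rw [← (cotangentBracket P φ).diffFun_compLinearMap (tangentBracket n M) (sharp P)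
      (fun _ => rfl) h.bracket_sharp]
    exact (cotangentBracket P φ).diffFun_smul _ _ _
  have h2 : (-sharpForm P (extDer η)) α =
      -((-1 : ℝ) ^ (k + 1) • (tangentBracket n M).diffFun η fun i => sharp P (α i)) := rfl
  rw [h1, h2, pow_succ, mul_neg_one, neg_smul, neg_neg]

/-- Every tangent vector is the value of a global vector field. -/
theorem exists_vectorField_apply_eq (x : M) (v : TangentSpace (𝓡 n) x) :
    ∃ X : SmoothVectorField n M, X x = v := by
  obtain ⟨s, hs, hsmooth⟩ := FiberBundle.exists_contMDiffOn_extend (k := ∞) (𝓡 n)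
    (EuclideanSpace ℝ (Fin n)) (V := (TangentSpace (𝓡 n) : M → Type)) v
  -- A bump function supported where the local extension is smooth makes it global; being 1 at `x`,
  -- it does not change the value there.
  obtain ⟨ψ, hψ, -⟩ :=
    (SmoothBumpFunction.nhds_basis_support (I := 𝓡 n) (interior_mem_nhds.2 hs)).mem_iff.1
      (interior_mem_nhds.2 hs)
  refine ⟨⟨(ψ : M → ℝ) • FiberBundle.extend (EuclideanSpace ℝ (Fin n))
    (E := (TangentSpace (𝓡 n) : M → Type)) v,
    ContMDiffOn.smul_section_of_tsupport ψ.contMDiff.contMDiffOn isOpen_interior hψ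
      (hsmooth.mono interior_subset)⟩, ?_⟩
  show ψ x • FiberBundle.extend (EuclideanSpace ℝ (Fin n))
    (E := (TangentSpace (𝓡 n) : M → Type)) v x = v
  rw [FiberBundle.extend_apply_self, ψ.eq_one, one_smul]

/-- If `n` vector fields and `n` one-forms decompose all vector fields up to a factor which is `1`
at `x`, they are dual to each other at `x`. -/
theorem coframe_apply_frame {x : M} {χ : SmoothFunction n M} (hχ : χ x = 1)
    {V : Fin n → SmoothVectorField n M} {c : Fin n → OneForm n M}
    (hV : ∀ X : SmoothVectorField n M, (χ * χ) • X = ∑ i, c i X • V i) (i j : Fin n) :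
    c i (V j) x = if i = j then 1 else 0 := by
  have hX : ∀ X : SmoothVectorField n M, X x = ∑ i, c i X x • V i x := fun X => by
    have h1 := congrArg (fun Y : SmoothVectorField n M => Y x) (hV X)
    rw [SmoothVectorField.sum_apply] at h1
    have h2 : (χ x * χ x) • X x = ∑ i, c i X x • V i x := h1
    simpa [hχ] using h2
  -- At `x` the decomposition has factor 1, so the n vectors V_i(x) span an n-dimensional space and
  -- form a basis. Duality then follows by comparing the two expansions of V_j(x).
  have hspan : ⊤ ≤ Submodule.span ℝ (Set.range fun i => V i x) := fun v _ => by
    obtain ⟨X, rfl⟩ := exists_vectorField_apply_eq x v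
    rw [hX X]
    exact Submodule.sum_mem _ fun i _ =>
      Submodule.smul_mem _ _ (Submodule.subset_span ⟨i, rfl⟩)
  have hli : LinearIndependent ℝ fun i => V i x :=
    linearIndependent_of_top_le_span_of_card_eq_finrank hspan (by
      show _ = Module.finrank ℝ (EuclideanSpace ℝ (Fin n))
      simp)
  have h1 : ∑ i, (c i (V j) x - if i = j then 1 else 0) • V i x = 0 := by
    simp [sub_smul, Finset.sum_sub_distrib, ← hX]
  exact sub_eq_zero.1 (Fintype.linearIndependent_iff.1 hli _ h1 i)

theorem sharp_injective {P : MultivectorField n M 2} (hP : IsNondegenerate P) :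
    Function.Injective (sharp P) := by
  refine (injective_iff_map_eq_zero _).2 fun α hα => ?_
  ext X x
  refine hP x α (fun β => ?_) X
  rw [← apply_sharp, hα, map_zero]
  rfl

/-- A nondegenerate bivector field is locally invertible. -/
theorem exists_smul_mem_range_sharp {P : MultivectorField n M 2} (hP : IsNondegenerate P) (x : M) :
    ∃ f : SmoothFunction n M, f x ≠ 0 ∧
      ∀ X : SmoothVectorField n M, ∃ θ : OneForm n M, sharp P θ = f • X := by
  obtain ⟨χ, V, c, hχ, hV, -⟩ := exists_local_frame (n := n) x
  have hx : χ x = 1 := hχ.self_of_nhds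
  let m : Matrix (Fin n) (Fin n) (SmoothFunction n M) := Matrix.of fun i j => P ![c i, c j]
  -- A left null vector v of the real matrix m(x) gives α = ∑ v_i c_i with P(α, ·) zero at `x`.
  -- Nondegeneracy makes α vanish at `x`, and duality of frame and coframe returns v_j = α(V_j)(x) =
  -- 0.
  have hdet : m.det x ≠ 0 := by
    intro h0
    let ev : SmoothFunction n M →+* ℝ :=
      { toFun f := f x
        map_one' := rfl
        map_mul' _ _ := rfl
        map_zero' := rfl
        map_add' _ _ := rfl }
    have h1 : (ev.mapMatrix m).det = 0 := by
      rw [← RingHom.map_det]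
      exact h0
    obtain ⟨v, hv, hvm⟩ := Matrix.exists_vecMul_eq_zero_iff.2 h1
    refine hv (funext fun j => ?_)
    let α : OneForm n M := ∑ i, algebraMap ℝ (SmoothFunction n M) (v i) • c i
    have hα : ∀ β, P ![α, β] x = 0 := by
      intro β
      -- The frame decomposition of vector fields dualizes to one-forms, so it is enough to test α
      -- against the c_i.
      have h2 : (χ * χ) • β = ∑ i, β (V i) • c i := by
        ext1 X
        rw [LinearMap.smul_apply, ← map_smul, hV, map_sum, LinearMap.sum_apply]
        refine Finset.sum_congr rfl fun i _ => ?_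
        rw [map_smul, LinearMap.smul_apply, smul_eq_mul, smul_eq_mul, mul_comm]
      have h3 : (χ * χ) * P ![α, β] = ∑ i, β (V i) * P ![α, c i] := by
        have := congrArg (P.contract α) h2
        rw [map_smul, map_sum] at this
        simp only [map_smul] at this
        exact this
      have h4 : ∀ i, P ![α, c i] x = 0 := by
        intro i
        have h5 : P ![α, c i] = ∑ l, algebraMap ℝ (SmoothFunction n M) (v l) * P ![c l, c i] := by
          rw [P.pair_skew, P.pair_sum, ← Finset.sum_neg_distrib]
          refine Finset.sum_congr rfl fun l _ => ?_
          rw [← P.pair_smul, P.pair_skew (_ • c l)]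
        rw [h5, SmoothFunction.sum_apply]
        exact congrFun hvm i
      have h6 := congrArg (fun g : SmoothFunction n M => g x) h3
      rw [SmoothFunction.sum_apply] at h6
      have h7 : χ x * χ x * P ![α, β] x = ∑ i, β (V i) x * P ![α, c i] x := h6
      simpa [hx, h4] using h7
    have h8 := hP x α hα (V j)
    have h9 : α (V j) = ∑ i, algebraMap ℝ (SmoothFunction n M) (v i) * c i (V j) := by
      rw [LinearMap.sum_apply]
      rfl
    rw [h9, SmoothFunction.sum_apply] at h8
    have h10 : ∑ i, v i * c i (V j) x = 0 := h8
    simpa [coframe_apply_frame hx hV] using h10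
  -- Cramer's rule: χ² P♯c_i = ∑ m_ij V_j, so the adjugate recovers det(m) V_k, and ∑ c_k(X) V_k =
  -- χ² X accounts for the remaining factor χ².
  refine ⟨(χ * χ) * m.det, ?_, fun X => ?_⟩
  · show χ x * χ x * m.det x ≠ 0
    simpa [hx] using hdet
  · refine ⟨∑ k, c k X • ∑ i, m.adjugate k i • (χ * χ) • c i, ?_⟩
    have h1 : ∀ i, (χ * χ) • sharp P (c i) = ∑ j, m i j • V j := fun i => by
      rw [hV]
      exact Finset.sum_congr rfl fun j _ => by rw [apply_sharp]; rfl
    have h2 : ∀ k, ∑ i, m.adjugate k i • (χ * χ) • sharp P (c i) = m.det • V k := fun k => by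
      have h3 := fun j => congrFun (congrFun m.adjugate_mul k) j
      simp only [Matrix.mul_apply] at h3
      simp only [h1, Finset.smul_sum, smul_smul]
      rw [Finset.sum_comm]
      simp only [← Finset.sum_smul, h3]
      simp [Matrix.one_apply]
    simp only [map_sum, map_smul, h2]
    rw [mul_comm (χ * χ), mul_smul, hV, Finset.smul_sum]
    exact Finset.sum_congr rfl fun k _ => smul_comm _ _ _

/-- The preimage of X is glued from the local solutions θ_x / f_x, evaluating at each point x the
solution attached to x itself. -/
theorem sharp_surjective {P : MultivectorField n M 2} (hP : IsNondegenerate P) :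
    Function.Surjective (sharp P) := by
  intro X
  choose f hf hθ using fun x : M => exists_smul_mem_range_sharp hP x
  choose θ hθ using fun x => hθ x X
  -- Both sides are sent by `P♯` to f_x f_y X.
  have hcomp : ∀ x y, f x • θ y = f y • θ x := fun x y => sharp_injective hP (by
    rw [map_smul, map_smul, hθ, hθ, smul_comm])
  have happ : ∀ (x₀ y : M) (Y : SmoothVectorField n M), f x₀ y ≠ 0 →
      θ y Y y / f y y = θ x₀ Y y / f x₀ y := by
    intro x₀ y Y h
    have h1 : f x₀ y * θ y Y y = f y y * θ x₀ Y y :=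
      congrArg (fun α : OneForm n M => α Y y) (hcomp x₀ y)
    rw [div_eq_div_iff (hf y) h]
    linarith
  let α : OneForm n M :=
    -- Near x₀, where f_{x₀} stays nonzero, this function equals the single smooth quotient
    -- θ_{x₀}(Y) / f_{x₀}.
    { toFun Y := ⟨fun x => θ x Y x / f x x, fun x₀ => by
        refine (((θ x₀ Y).contMDiff x₀).div₀ ((f x₀).contMDiff x₀)
          (hf x₀)).congr_of_eventuallyEq ?_
        filter_upwards [(f x₀).contMDiff.continuous.continuousAt.eventually_ne (hf x₀)] with y hy
        exact happ x₀ y Y hy⟩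
      map_add' Y Z := by
        ext x
        show θ x (Y + Z) x / f x x = θ x Y x / f x x + θ x Z x / f x x
        rw [map_add, ← add_div]
        rfl
      map_smul' g Y := by
        ext x
        show θ x (g • Y) x / f x x = g x * (θ x Y x / f x x)
        rw [map_smul, ← mul_div_assoc]
        rfl }
  refine ⟨α, SmoothVectorField.ext_of_forall fun β => ?_⟩
  ext x
  have h1 : β (sharp P (θ x)) x = f x x * β X x := by
    rw [hθ, map_smul]
    rfl
  -- Skew-adjointness turns this into a value of α, which is read off from its pointwise definition;
  -- `h3` applies it in the other direction to θ_x.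
  have h2 : β (sharp P α) x = -(θ x (sharp P β) x / f x x) := by
    rw [OneForm.apply_sharp_swap]
    rfl
  have h3 : θ x (sharp P β) x = -(β (sharp P (θ x)) x) := by
    rw [OneForm.apply_sharp_swap]
    rfl
  rw [h2, h3, h1]
  field_simp [hf x]

/-! ### Bijectivity of `P♯` on forms of every degree. -/

/-- `P♯` on `k`-forms as a linear map. -/
def sharpFormLM (P : MultivectorField n M 2) (k : ℕ) :
    DiffForm n M k →ₗ[ℝ] MultivectorField n M k where
  toFun := sharpForm P
  map_add' η θ := smul_add ((-1 : ℝ) ^ k) (η.compLinearMap (sharp P)) (θ.compLinearMap (sharp P))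
  map_smul' c η := smul_comm ((-1 : ℝ) ^ k) c (η.compLinearMap (sharp P))

theorem sharpForm_bijective {P : MultivectorField n M 2} (hP : IsNondegenerate P) (k : ℕ) :
    Function.Bijective (sharpFormLM P k) := by
  let e := LinearEquiv.ofBijective (sharp P) ⟨sharp_injective hP, sharp_surjective hP⟩
  have he : ∀ α, sharp P α = e α := fun _ => rfl
  have hsq : (-1 : ℝ) ^ k * (-1) ^ k = 1 := by rw [← mul_pow]; simp
  -- The inverse is pullback along the inverse of `P♯` with the same sign, as (-1)^k squares to 1.
  refine Function.bijective_iff_has_inverse.2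
    ⟨fun Q => (-1 : ℝ) ^ k • Q.compLinearMap e.symm.toLinearMap, fun η => ?_, fun Q => ?_⟩
  · ext1 X
    show (-1 : ℝ) ^ k • (-1 : ℝ) ^ k • η (fun i => sharp P (e.symm (X i))) = η X
    simp [he, smul_smul, hsq]
  · ext1 α
    show (-1 : ℝ) ^ k • (-1 : ℝ) ^ k • Q (fun i => e.symm (sharp P (α i))) = Q α
    simp [he, smul_smul, hsq]

/-! ### Passage to cohomology. -/

section
variable {P : MultivectorField n M 2} {φ : DiffForm n M 3}

theorem IsTwistedPoisson.diffLM_sharpFormLM (h : IsTwistedPoisson P φ) {k : ℕ}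
    (η : DiffForm n M k) :
    (cotangentBracket P φ).diffLM k (sharpFormLM P k η) =
      -sharpFormLM P (k + 1) ((tangentBracket n M).diffLM k η) :=
  h.lichDer_sharpForm η

theorem IsTwistedPoisson.sharpFormLM_mem_cocycles (h : IsTwistedPoisson P φ) {k : ℕ}
    {η : DiffForm n M k} (hη : η ∈ (tangentBracket n M).cocycles k) :
    sharpFormLM P k η ∈ (cotangentBracket P φ).cocycles k := by
  have h1 : (tangentBracket n M).diffLM k η = 0 := hη
  show (cotangentBracket P φ).diffLM k _ = 0
  rw [h.diffLM_sharpFormLM, h1, map_zero, neg_zero]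

theorem IsTwistedPoisson.sharpFormLM_mem_coboundaries (h : IsTwistedPoisson P φ) {k : ℕ}
    {η : DiffForm n M k} (hη : η ∈ (tangentBracket n M).coboundaries k) :
    sharpFormLM P k η ∈ (cotangentBracket P φ).coboundaries k := by
  cases k with
  | zero =>
    have h1 : η = 0 := hη
    rw [h1, map_zero]
    exact Submodule.zero_mem _
  | succ k =>
    obtain ⟨θ, rfl⟩ := hη
    -- The minus sign in ∂_φ P♯ = -P♯ d is absorbed in the primitive.
    exact ⟨-sharpFormLM P k θ, by rw [map_neg, h.diffLM_sharpFormLM, neg_neg]⟩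

theorem IsTwistedPoisson.mem_cocycles_of_sharpFormLM (h : IsTwistedPoisson P φ)
    (hP : IsNondegenerate P) {k : ℕ} {η : DiffForm n M k}
    (hη : sharpFormLM P k η ∈ (cotangentBracket P φ).cocycles k) :
    η ∈ (tangentBracket n M).cocycles k := by
  have h1 : (cotangentBracket P φ).diffLM k (sharpFormLM P k η) = 0 := hη
  rw [h.diffLM_sharpFormLM, neg_eq_zero] at h1
  exact (sharpForm_bijective hP (k + 1)).1 (h1.trans (map_zero _).symm)

/-- Two degrees are involved: a primitive is lifted by surjectivity in the lower degree, and the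
resulting equation is pulled back by injectivity in the upper one. In degree zero only injectivity
is needed, the coboundaries being zero. -/
theorem IsTwistedPoisson.mem_coboundaries_of_sharpFormLM (h : IsTwistedPoisson P φ)
    (hP : IsNondegenerate P) {k : ℕ} {η : DiffForm n M k}
    (hη : sharpFormLM P k η ∈ (cotangentBracket P φ).coboundaries k) :
    η ∈ (tangentBracket n M).coboundaries k := by
  cases k with
  | zero =>
    have h1 : sharpFormLM P 0 η = 0 := hη
    exact (sharpForm_bijective hP 0).1 (h1.trans (map_zero _).symm)
  | succ k =>
    obtain ⟨Q, hQ⟩ := hη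
    obtain ⟨θ, rfl⟩ := (sharpForm_bijective hP k).2 Q
    rw [h.diffLM_sharpFormLM, ← map_neg] at hQ
    exact ⟨-θ, by rw [map_neg]; exact (sharpForm_bijective hP (k + 1)).1 hQ⟩

/-- The map `P♯` from de Rham cohomology to Lichnerowicz-twisted Poisson cohomology. -/
def IsTwistedPoisson.sharpCohomology (h : IsTwistedPoisson P φ) (k : ℕ) :
    DeRhamCohomology n M k →ₗ[ℝ] LtPCohomology P φ k :=
  Subquotient.map (sharpFormLM P k) (fun _ => h.sharpFormLM_mem_cocycles)
    fun _ => h.sharpFormLM_mem_coboundaries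

theorem IsTwistedPoisson.sharpCohomology_bijective (h : IsTwistedPoisson P φ)
    (hP : IsNondegenerate P) (k : ℕ) : Function.Bijective (h.sharpCohomology k) :=
  Subquotient.map_bijective _ _ _ (sharpForm_bijective hP k).2
    (fun _ => h.mem_cocycles_of_sharpFormLM hP) fun _ => h.mem_coboundaries_of_sharpFormLM hP

end

end TwistedPoisson

end

theorem mainTheorem4 (n : ℕ) (M : Type*) [TopologicalSpace M]
    [ChartedSpace (EuclideanSpace ℝ (Fin n)) M] [IsManifold (𝓡 n) ∞ M]
    [T2Space M] [SigmaCompactSpace M]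
    (Λ : TwistedPoisson.MultivectorField n M 2) (φ : TwistedPoisson.DiffForm n M 3)
    (hΛ : TwistedPoisson.IsTwistedPoisson Λ φ) :
    (∀ (k : ℕ) (η : TwistedPoisson.DiffForm n M k),
      TwistedPoisson.lichDer Λ φ (TwistedPoisson.sharpForm Λ η) =
        -TwistedPoisson.sharpForm Λ (TwistedPoisson.extDer η)) ∧
    ∃ F : (k : ℕ) → TwistedPoisson.DeRhamCohomology n M k →ₗ[ℝ]
        TwistedPoisson.LtPCohomology Λ φ k,
      (∀ (k : ℕ) (η : TwistedPoisson.DiffForm n M k) (hη : TwistedPoisson.extDer η = 0),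
        ∃ hQ : TwistedPoisson.lichDer Λ φ (TwistedPoisson.sharpForm Λ η) = 0,
          F k (TwistedPoisson.deRhamClass η hη) =
            TwistedPoisson.ltpClass Λ φ (TwistedPoisson.sharpForm Λ η) hQ) ∧
      (TwistedPoisson.IsNondegenerate Λ → ∀ k : ℕ, Function.Bijective (F k)) :=
  ⟨fun _ η => hΛ.lichDer_sharpForm η, hΛ.sharpCohomology,
    -- The induced map is computed on representatives, so the equation of classes holds by
    -- definition.
    fun _ _ hη => ⟨hΛ.sharpFormLM_mem_cocycles hη, rfl⟩, hΛ.sharpCohomology_bijective⟩
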